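/- Let $m\ge 2$, $c\ge 0$ and $\alpha>-1$. Let $\mathbb{R}_m$ be the real Clifford algebra generated by $e_1,\dots,e_m$ with $e_j^2=-1$ and $e_ie_j=-e_je_i$ for $i\ne j$, let $\mathbb{C}_m=\mathbb{C}\otimes_{\mathbb R}\mathbb{R}_m$ be its complexification, let $\lambda\mapsto\overline{\lambda}$ be the antilinear anti-automorphism of $\mathbb{C}_m$ with $\overline{e_j}=-e_j$, and put $|\lambda|^2=\sum_A|\lambda_A|^2$ for $\lambda=\sum_A\lambda_Ae_A$. Let $\partial_x f=\sum_{j=1}^m e_j\,\partial_{x_j}f$ be the Dirac operator, and on the open unit ball $B(1)\subset\mathbb{R}^m$ put $$\mathcal{L}_{c,\alpha}f(x)=(1-|x|^2)^{-\alpha}\,\partial_x\big((1-|x|^2)^{\alpha+1}\,\partial_xf(x)\big)+4\pi^2c^2|x|^2f(x).$$ For $k\ge 0$ let $M_l^+(k)$ be the right $\mathbb{C}_m$-module of $\mathbb{C}_m$-valued homogeneous polynomials $Y$ of degree $k$ on $\mathbb{R}^m$ with $\partial_xY=0$, let $d_{k,m}=\binom{m+k-2}{k}$, and let $\{Y_k^i\}_{i=1}^{d_{k,m}}$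 be an orthonormal basis of it: the $Y_k^i$ span $M_l^+(k)$ over $\mathbb{C}_m$ (acting on the right), and $\int_{S^{m-1}}\overline{Y_k^i(\omega)}\,Y_k^{j}(\omega)\,d\omega=\delta_{ij}$. For each $k\ge0$, consider the real eigenvalues of $\mathcal{L}_{c,\alpha}$ on $B(1)$ with eigenfunctions $F(|x|^2)Y(x)$, where $Y\in M_l^+(k)$ and $F\in C^\infty([0,1],\mathbb{R})$, $F\not\equiv0$ (they do not depend on $Y\neq 0$). For $N\ge0$ let $\chi_{2N}$ be an eigenvalue of this kind below which there are exactly $N$ others, and let $P_{N}^{k}\in C^\infty([0,1],\mathbb{R})$ be such that $P_{N}^{k}(|x|^2)Y(x)$ satisfies $\mathcal{L}_{c,\alpha}f=\chi_{2N}f$ for all $Y\in M_l^+(k)$, normalised by $$\int_0^1P_{N}^{k}(t)^2\,t^{k+\frac m2-1}(1-t)^\alpha\,dt=1 .$$ The even weighted Clifford prolate spheroidal wave functions are $\psi_{2N}^{k,i}(x)=P_{N}^{k}(|x|^2)\,Y_k^i(x)$. Then each $\psi_{2N}^{k,i}$ belongs to $L^2_\alpha(B(1),\mathbb{C}_m)$,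 i.e. it is measurable and $\int_{B(1)}|\psi_{2N}^{k,i}(x)|^2(1-|x|^2)^\alpha\,dx<\infty$, and these functions are mutually orthogonal: for all $N,N',k,k'\ge0$, $1\le i\le d_{k,m}$, $1\le i'\le d_{k',m}$, $$\int_{B(1)}\overline{\psi_{2N}^{k,i}(x)}\;\psi_{2N'}^{k',i'}(x)\,(1-|x|^2)^\alpha\,dx=\tfrac12\,\delta_{NN'}\,\delta_{kk'}\,\delta_{ii'} .$$ -/

import Mathlib

open MeasureTheory Set
open scoped TensorProduct ContDiff

noncomputable section

namespace CPSWF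

/-- The quadratic form `x ↦ -(x₁² + ⋯ + xₘ²)` on `ℝᵐ`. -/
abbrev negSq (m : ℕ) : QuadraticForm ℝ (Fin m → ℝ) :=
  QuadraticMap.weightedSumSquares ℝ (fun _ : Fin m => (-1 : ℝ))

instance instStarModuleReal (m : ℕ) : StarModule ℝ (CliffordAlgebra (negSq m)) :=
  ⟨fun r x => by rw [CliffordAlgebra.star_smul, star_trivial r]⟩

/-- The complex Clifford algebra `ℂₘ`, the complexification of the real Clifford algebra `ℝₘ`
in which `eⱼ² = -1` and `eᵢ eⱼ = -eⱼ eᵢ` for `i ≠ j`. -/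
def ComplexClifford (m : ℕ) : Type := ℂ ⊗[ℝ] CliffordAlgebra (negSq m)

instance instRing (m : ℕ) : Ring (ComplexClifford m) :=
  inferInstanceAs (Ring (ℂ ⊗[ℝ] CliffordAlgebra (negSq m)))

instance instAlgebra (m : ℕ) : Algebra ℂ (ComplexClifford m) :=
  inferInstanceAs (Algebra ℂ (ℂ ⊗[ℝ] CliffordAlgebra (negSq m)))

/-- The Hermitian conjugation: complex conjugation of the scalars combined with the
anti-automorphism of `ℝₘ` that sends each `eⱼ` to `-eⱼ`. -/
instance instStarRing (m : ℕ) : StarRing (ComplexClifford m) :=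
  inferInstanceAs (StarRing (ℂ ⊗[ℝ] CliffordAlgebra (negSq m)))

/-- The generator `eⱼ` of `ℂₘ`. -/
def gen {m : ℕ} (j : Fin m) : ComplexClifford m :=
  (1 : ℂ) ⊗ₜ[ℝ] CliffordAlgebra.ι (negSq m) (Pi.single j 1)

theorem gen_mul_self {m : ℕ} (j : Fin m) : gen j * gen j = -1 := by
  have h : CliffordAlgebra.ι (negSq m) (Pi.single j 1) * CliffordAlgebra.ι (negSq m)
      (Pi.single j 1) = -1 := by
    rw [CliffordAlgebra.ι_sq_scalar]
    simp [negSq, QuadraticMap.weightedSumSquares_apply, Pi.single_apply]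
  have h2 : ((1 : ℂ) ⊗ₜ[ℝ] CliffordAlgebra.ι (negSq m) (Pi.single j 1)) *
      ((1 : ℂ) ⊗ₜ[ℝ] CliffordAlgebra.ι (negSq m) (Pi.single j 1)) = -1 := by
    rw [Algebra.TensorProduct.tmul_mul_tmul, h, one_mul, TensorProduct.tmul_neg,
      Algebra.TensorProduct.one_def]
  exact h2

theorem star_gen {m : ℕ} (j : Fin m) : star (gen j) = -gen j := by
  have h : star ((1 : ℂ) ⊗ₜ[ℝ] CliffordAlgebra.ι (negSq m) (Pi.single j 1)) =
      -((1 : ℂ) ⊗ₜ[ℝ] CliffordAlgebra.ι (negSq m) (Pi.single j 1)) := by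
    rw [TensorProduct.star_tmul, star_one, CliffordAlgebra.star_ι, TensorProduct.tmul_neg]
  exact h

theorem star_smul_complex {m : ℕ} (z : ℂ) (a : ComplexClifford m) :
    star (z • a) = star z • star a := by
  have h : ∀ x : ℂ ⊗[ℝ] CliffordAlgebra (negSq m), star (z • x) = star z • star x := by
    intro x
    induction x with
    | zero => simp
    | tmul w y => simp [TensorProduct.smul_tmul']
    | add x y hx hy => rw [smul_add, star_add, star_add, smul_add, hx, hy]
  exact h a

/-- The basis `(e_A)` of `ℂₘ`, where `A` runs through the subsets of `{1, …, m}` and `e_A` is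
the product of the `eⱼ` with `j ∈ A` in increasing order of `j`; it is obtained from the basis of
the exterior algebra by the standard linear isomorphism, which respects products of distinct
(hence orthogonal) generators. -/
def basis (m : ℕ) : Module.Basis (Finset (Fin m)) ℂ (ComplexClifford m) :=
  Algebra.TensorProduct.basis ℂ
    ((Pi.basisFun ℝ (Fin m)).ExteriorAlgebra.map
      (CliffordAlgebra.equivExterior (negSq m)).symm)

/-- The coordinates `(λ_A)` of a Clifford number, in Hermitian space. -/
def coord (m : ℕ) : ComplexClifford m ≃ₗ[ℂ] EuclideanSpace ℂ (Finset (Fin m)) :=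
  (basis m).equivFun.trans (WithLp.linearEquiv 2 ℂ (Finset (Fin m) → ℂ)).symm

/-- The norm of `ℂₘ`: `|λ|² = ∑_A |λ_A|²`. -/
instance instNormedAddCommGroup (m : ℕ) : NormedAddCommGroup (ComplexClifford m) :=
  NormedAddCommGroup.induced _ _ (coord m) (coord m).injective

instance instNormedSpace (m : ℕ) : NormedSpace ℂ (ComplexClifford m) :=
  NormedSpace.induced ℂ _ _ (coord m)

/-- Euclidean space `ℝᵐ`. -/
abbrev Euc (m : ℕ) : Type := EuclideanSpace ℝ (Fin m)

/-- The Dirac operator `∂ₓ f = ∑ⱼ eⱼ ∂f/∂xⱼ`. -/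
def dirac {m : ℕ} (f : Euc m → ComplexClifford m) (x : Euc m) : ComplexClifford m :=
  ∑ j : Fin m, gen j * fderiv ℝ f x (EuclideanSpace.single j 1)

/-- The operator
`L_{c,α} f = (1-|x|²)^{-α} ∂ₓ((1-|x|²)^{α+1} ∂ₓ f) + 4π²c²|x|² f`. -/
def opL {m : ℕ} (c α : ℝ) (f : Euc m → ComplexClifford m) (x : Euc m) : ComplexClifford m :=
  ((1 - ‖x‖ ^ 2) ^ (-α) : ℝ) •
      dirac (fun y => ((1 - ‖y‖ ^ 2) ^ (α + 1) : ℝ) • dirac f y) x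
    + (4 * Real.pi ^ 2 * c ^ 2 * ‖x‖ ^ 2 : ℝ) • f x

/-- `M_l⁺(k)`: the homogeneous polynomials of degree `k` on `ℝᵐ` with values in `ℂₘ` (finite sums
of monomials of degree `k` with Clifford coefficients) that are left monogenic. -/
def sphericalMonogenics (m k : ℕ) : Set (Euc m → ComplexClifford m) :=
  {f | (∃ a : (Fin m → ℕ) → ComplexClifford m,
        ∀ x, f x = ∑ β ∈ Finset.piAntidiag Finset.univ k, (∏ j, x j ^ β j : ℝ) • a β) ∧
      ∀ x, dirac f x = 0}

/-- `(Y_j)` is an orthonormal basis of the right `ℂₘ`-module `M_l⁺(k)`: its members lie in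
`M_l⁺(k)`, their `ℂₘ`-valued inner products over the unit sphere (with surface measure) are
`δ_{jj'}`, and every element of `M_l⁺(k)` is a right `ℂₘ`-linear combination of them. -/
structure IsOrthonormalBasis (m k : ℕ) {ι : Type} [Fintype ι] [DecidableEq ι]
    (Y : ι → Euc m → ComplexClifford m) : Prop where
  mem : ∀ j, Y j ∈ sphericalMonogenics m k
  orthonormal : ∀ j j',
    ∫ w : Metric.sphere (0 : Euc m) 1, star (Y j w) * Y j' w ∂((volume : Measure (Euc m)).toSphere)
      = if j = j' then 1 else 0
  span : ∀ f ∈ sphericalMonogenics m k,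
    ∃ a : ι → ComplexClifford m, ∀ x, f x = ∑ j, Y j x * a j

/-- The function `x ↦ F(|x|²) Y(x)`. -/
def radialMul {m : ℕ} (F : ℝ → ℝ) (Y : Euc m → ComplexClifford m) (x : Euc m) :
    ComplexClifford m :=
  F (‖x‖ ^ 2) • Y x

/-- `F ∈ C^∞([0,1], ℝ)` and, for every `Y ∈ M_l⁺(k)`, the function `F(|x|²) Y(x)` satisfies
`L_{c,α} f = χ f` in the unit ball. -/
structure SolvesEven (m k : ℕ) (c α : ℝ) (χ : ℝ) (F : ℝ → ℝ) : Prop where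
  smooth : ContDiffOn ℝ ∞ F (Icc 0 1)
  eqn : ∀ Y ∈ sphericalMonogenics m k, ∀ x ∈ Metric.ball (0 : Euc m) 1,
    opL c α (radialMul F Y) x = χ • radialMul F Y x

/-- The eigenvalues of `L_{c,α}` that have an eigenfunction of the form `F(|x|²) Y(x)` with
`F ∈ C^∞([0,1], ℝ)` not identically zero and `Y ∈ M_l⁺(k)`. -/
def evenEigenvalues (m k : ℕ) (c α : ℝ) : Set ℝ :=
  {χ | ∃ F : ℝ → ℝ, SolvesEven m k c α χ F ∧ ∃ t ∈ Icc (0 : ℝ) 1, F t ≠ 0}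

/-- `P` is the radial part of the `N`-th even weighted Clifford prolate spheroidal wave
functions of degree `k`: `P(|x|²) Y(x)` is an eigenfunction of `L_{c,α}` for the `N`-th smallest
(counting from `0`) eigenvalue `χ`, and `P` has unit norm in
`L²([0,1], t^{k+m/2-1} (1-t)^α)`. -/
def IsEvenRadialPart (m k N : ℕ) (c α : ℝ) (P : ℝ → ℝ) : Prop :=
  (∃ χ : ℝ, SolvesEven m k c α χ P ∧ {μ ∈ evenEigenvalues m k c α | μ < χ}.encard = N) ∧
  ∫ t in (0 : ℝ)..1, P t ^ 2 * (t ^ ((k : ℝ) + (m : ℝ) / 2 - 1) * (1 - t) ^ α) = 1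

/-- The measure `(1-|x|²)^α dx` on the unit ball `B(1)`. -/
def ballMeasure (m : ℕ) (α : ℝ) : Measure (Euc m) :=
  (volume.restrict (Metric.ball 0 1)).withDensity fun x => ENNReal.ofReal ((1 - ‖x‖ ^ 2) ^ α)

/-- The `ℂₘ`-valued inner product of `L²_α(B(1), ℂₘ)`. -/
def weightedInner {m : ℕ} (α : ℝ) (f g : Euc m → ComplexClifford m) : ComplexClifford m :=
  ∫ x, star (f x) * g x ∂(ballMeasure m α)

end CPSWF

end

noncomputable section

namespace CPSWF

variable {m : ℕ}

/-! In polar coordinates the inner product of $F(|x|^2)Y$ and $G(|x|^2)Z$ splits into a real radial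
integral times the spherical inner product of $Y$ and $Z$ (`weightedInner_radialMul`), so three
facts suffice.

Different degrees $k\ne l$: the sphere factor vanishes. The function $\varphi(|x|^2)\,xZ$ has Dirac
derivative of the form (radial) times $Z$, and pairing it with the monogenic $Y$ gives zero by
parts. This reads $(A+(m+2l)B)\langle Y,Z\rangle=0$ with $A,B$ symmetric in the degrees; exchanging
$Y$ and $Z$ replaces $l$ by $k$, and $B>0$ for a bump $\varphi$.

Same degree, different $N$: the eigenvalue equation reduces to a Sturm–Liouville equation with
$p=t^{k+m/2}(1-t)^{\alpha+1}$ and weight $t^{k+m/2-1}(1-t)^\alpha$ (`SolvesEven.hasDerivAt`). Since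
$p$ vanishes at both endpoints, Lagrange's identity makes solutions for distinct eigenvalues
orthogonal.

Same degree and $N$: the substitution $t=r^2$ turns the normalisation of $P$ into the factor
$\tfrac12$. -/

/-! ### Algebra of $\mathbb{C}_m$ and the vector variable. -/

instance instFiniteDimensionalComplex (m : ℕ) : FiniteDimensional ℂ (ComplexClifford m) :=
  Module.Finite.of_basis (basis m)

/-- Finite dimension makes the product and the conjugation continuous. -/
instance instFiniteDimensionalReal (m : ℕ) : FiniteDimensional ℝ (ComplexClifford m) :=
  Module.Finite.trans ℂ _

instance instNontrivial (m : ℕ) : Nontrivial (ComplexClifford m) :=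
  ⟨basis m ∅, 0, (basis m).ne_zero ∅⟩

theorem star_smul_real (r : ℝ) (a : ComplexClifford m) : star (r • a) = r • star a := by
  have h := star_smul_complex (r : ℂ) a
  simpa using h

/-- The product of `ℂₘ` as a continuous real-bilinear map. -/
def mulL (m : ℕ) : ComplexClifford m →L[ℝ] ComplexClifford m →L[ℝ] ComplexClifford m :=
  (LinearMap.mul ℝ (ComplexClifford m)).toContinuousBilinearMap

@[simp] theorem mulL_apply (a b : ComplexClifford m) : mulL m a b = a * b := rfl

/-- The conjugation of `ℂₘ` as a continuous real-linear map. -/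
def starL (m : ℕ) : ComplexClifford m →L[ℝ] ComplexClifford m :=
  LinearMap.toContinuousLinearMap
    { toFun := star
      map_add' := star_add
      map_smul' := star_smul_real }

@[simp] theorem starL_apply (a : ComplexClifford m) : starL m a = star a := rfl

theorem gen_mul_gen_add_swap {i j : Fin m} (h : i ≠ j) :
    (gen i * gen j + gen j * gen i : ComplexClifford m) = 0 := by
  have h0 : CliffordAlgebra.ι (negSq m) (Pi.single i 1) * CliffordAlgebra.ι (negSq m)
      (Pi.single j 1) + CliffordAlgebra.ι (negSq m) (Pi.single j 1) *
      CliffordAlgebra.ι (negSq m) (Pi.single i 1) = 0 := by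
    rw [CliffordAlgebra.ι_mul_ι_add_swap]
    have : QuadraticMap.polar (negSq m) (Pi.single i 1) (Pi.single j 1) = 0 := by
      simp only [QuadraticMap.polar, negSq, QuadraticMap.weightedSumSquares_apply,
        ← Finset.sum_sub_distrib, Pi.add_apply]
      refine Finset.sum_eq_zero fun l _ => ?_
      rcases eq_or_ne l i with rfl | hl
      · simp [h]
      · simp [hl]
    rw [this, map_zero]
  have h2 : ((1 : ℂ) ⊗ₜ[ℝ] CliffordAlgebra.ι (negSq m) (Pi.single i 1)) *
      ((1 : ℂ) ⊗ₜ[ℝ] CliffordAlgebra.ι (negSq m) (Pi.single j 1)) +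
      ((1 : ℂ) ⊗ₜ[ℝ] CliffordAlgebra.ι (negSq m) (Pi.single j 1)) *
      ((1 : ℂ) ⊗ₜ[ℝ] CliffordAlgebra.ι (negSq m) (Pi.single i 1)) = 0 := by
    rw [Algebra.TensorProduct.tmul_mul_tmul, Algebra.TensorProduct.tmul_mul_tmul,
      ← TensorProduct.tmul_add, h0, TensorProduct.tmul_zero]
  exact h2

/-- The vector variable `x = ∑ⱼ xⱼ eⱼ` of `ℂₘ`. -/
def vec (m : ℕ) : Euc m →L[ℝ] ComplexClifford m :=
  ∑ j, (EuclideanSpace.proj j : Euc m →L[ℝ] ℝ).smulRight (gen j)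

theorem vec_apply (x : Euc m) : vec m x = ∑ j, x j • gen j := by
  simp [vec]

@[simp] theorem vec_single (j : Fin m) : vec m (EuclideanSpace.single j 1) = gen j := by
  simp [vec_apply, ite_smul]

theorem gen_mul_vec (j : Fin m) (x : Euc m) :
    gen j * vec m x = -(vec m x * gen j) - (2 * x j) • 1 := by
  have h : gen j * vec m x + vec m x * gen j = ∑ i, x i • (gen j * gen i + gen i * gen j) := by
    simp only [vec_apply, Finset.mul_sum, Finset.sum_mul, ← Finset.sum_add_distrib,
      mul_smul_comm, smul_mul_assoc, smul_add]
  rw [Finset.sum_eq_single j (fun i _ hi => by rw [gen_mul_gen_add_swap hi.symm, smul_zero])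
    (by simp), gen_mul_self] at h
  rw [eq_sub_iff_add_eq, eq_neg_iff_add_eq_zero, add_right_comm, h]
  module

theorem vec_mul_self (x : Euc m) : vec m x * vec m x = -(‖x‖ ^ 2) • 1 := by
  have h : vec m x * vec m x = ∑ j, x j • (gen j * vec m x) := by
    conv_lhs => lhs; rw [vec_apply]
    simp only [Finset.sum_mul, smul_mul_assoc]
  have h1 : ∑ j, x j • (vec m x * gen j) = vec m x * vec m x := by
    conv_rhs => rhs; rw [vec_apply]
    simp only [Finset.mul_sum, mul_smul_comm]
  -- Expand only the left factor and move each $e_j$ past the right one; the same square returns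
  -- with the opposite sign, so the equation can be solved for it.
  have h2 : vec m x * vec m x = -(vec m x * vec m x) - (2 * ‖x‖ ^ 2) • 1 := by
    nth_rewrite 1 [h]
    simp only [gen_mul_vec, smul_sub, smul_neg, Finset.sum_sub_distrib, Finset.sum_neg_distrib, h1,
      smul_smul, ← Finset.sum_smul]
    congr 2
    rw [EuclideanSpace.real_norm_sq_eq, Finset.mul_sum]
    exact Finset.sum_congr rfl fun j _ => by ring
  have h3 : (2 : ℝ) • (vec m x * vec m x) = (2 : ℝ) • (-(‖x‖ ^ 2) • (1 : ComplexClifford m)) := by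
    rw [two_smul]
    nth_rewrite 1 [h2]
    module
  exact smul_right_injective _ (two_ne_zero' ℝ) h3

/-! ### The Dirac operator on radial multiples. -/

theorem dirac_congr {f g : Euc m → ComplexClifford m} {x : Euc m} (h : f =ᶠ[nhds x] g) :
    dirac f x = dirac g x := by
  simp only [dirac, h.fderiv_eq]

theorem dirac_smul {h : Euc m → ℝ} {f : Euc m → ComplexClifford m} {x : Euc m}
    (hh : DifferentiableAt ℝ h x) (hf : DifferentiableAt ℝ f x) :
    dirac (fun y => h y • f y) x =
      h x • dirac f x + (∑ j, fderiv ℝ h x (EuclideanSpace.single j 1) • gen j) * f x := by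
  simp only [dirac, Finset.smul_sum, Finset.sum_mul, ← Finset.sum_add_distrib]
  refine Finset.sum_congr rfl fun j _ => ?_
  rw [fderiv_fun_smul hh hf]
  simp only [add_apply, smul_apply,
    ContinuousLinearMap.smulRight_apply, mul_add, mul_smul_comm, smul_mul_assoc]

theorem hasFDerivAt_radial {φ : ℝ → ℝ} {φ' : ℝ} {x : Euc m} (h : HasDerivAt φ φ' (‖x‖ ^ 2)) :
    HasFDerivAt (fun y : Euc m => φ (‖y‖ ^ 2)) (φ' • (2 • innerSL ℝ x)) x :=
  h.comp_hasFDerivAt x (HasStrictFDerivAt.hasFDerivAt (hasStrictFDerivAt_norm_sq x))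

/-- The Dirac operator applied to a radial function times `f`. -/
theorem dirac_radial_smul {φ : ℝ → ℝ} {φ' : ℝ} {f : Euc m → ComplexClifford m} {x : Euc m}
    (h : HasDerivAt φ φ' (‖x‖ ^ 2)) (hf : DifferentiableAt ℝ f x) :
    dirac (fun y => φ (‖y‖ ^ 2) • f y) x =
      φ (‖x‖ ^ 2) • dirac f x + (2 * φ') • (vec m x * f x) := by
  have hd := hasFDerivAt_radial h
  rw [dirac_smul hd.differentiableAt hf, hd.fderiv, ← smul_mul_assoc, vec_apply, Finset.smul_sum]
  congr 2
  refine Finset.sum_congr rfl fun j _ => ?_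
  rw [smul_smul]
  congr 1
  simp [EuclideanSpace.inner_single_right]
  ring

theorem fderiv_vec_mul {f : Euc m → ComplexClifford m} {x : Euc m} (hf : DifferentiableAt ℝ f x)
    (v : Euc m) :
    fderiv ℝ (fun y => vec m y * f y) x v = vec m x * fderiv ℝ f x v + vec m v * f x := by
  have h := ((mulL m).hasFDerivAt_of_bilinear (vec m).hasFDerivAt hf.hasFDerivAt).fderiv
  simp only [mulL_apply] at h
  rw [h]
  simp [ContinuousLinearMap.precompR_apply, ContinuousLinearMap.precompL_apply]

theorem differentiableAt_vec_mul {f : Euc m → ComplexClifford m} {x : Euc m}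
    (hf : DifferentiableAt ℝ f x) : DifferentiableAt ℝ (fun y => vec m y * f y) x :=
  ((mulL m).hasFDerivAt_of_bilinear (vec m).hasFDerivAt hf.hasFDerivAt).differentiableAt

theorem euc_eq_sum (x : Euc m) : x = ∑ j, x j • EuclideanSpace.single j (1 : ℝ) := by
  ext i
  simp [Pi.single_apply]

/-- Anticommuting $e_j$ past $x$ gives $\partial(xf)=-x\,\partial f-2Ef-mf$ with $E$ the Euler
operator; here $\partial f=0$ and $Ef=kf$. -/
theorem dirac_vec_mul {f : Euc m → ComplexClifford m} {x : Euc m} {k : ℕ}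
    (hf : DifferentiableAt ℝ f x) (hd : dirac f x = 0) (he : fderiv ℝ f x x = (k : ℝ) • f x) :
    dirac (fun y => vec m y * f y) x = -(m + 2 * k : ℝ) • f x := by
  have h1 : ∀ j : Fin m, gen j * fderiv ℝ (fun y => vec m y * f y) x (EuclideanSpace.single j 1) =
      -(vec m x * (gen j * fderiv ℝ f x (EuclideanSpace.single j 1)))
        - (2 : ℝ) • fderiv ℝ f x (x j • EuclideanSpace.single j (1 : ℝ)) - f x := by
    intro j
    rw [fderiv_vec_mul hf, mul_add, ← mul_assoc, gen_mul_vec, vec_single, ← mul_assoc,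
      gen_mul_self, sub_mul, neg_mul, mul_assoc, map_smul, smul_mul_assoc, one_mul, neg_one_mul,
      mul_smul, sub_eq_add_neg _ (f x)]
  rw [dirac, Finset.sum_congr rfl fun j _ => h1 j]
  simp only [Finset.sum_sub_distrib, Finset.sum_neg_distrib, ← Finset.mul_sum, ← Finset.smul_sum,
    ← map_sum]
  rw [← euc_eq_sum, he]
  have : ∑ j, gen j * fderiv ℝ f x (EuclideanSpace.single j 1) = 0 := hd
  rw [this]
  simp only [mul_zero, Finset.sum_const, Finset.card_univ, Fintype.card_fin]
  module

/-- Since $x^2=-|x|^2$, the operator carries radial multiples of $xY$ back to radial multiples of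
$Y$; hence $\mathcal L_{c,\alpha}$ acts on the radial factor alone. -/
theorem dirac_radial_smul_vec_mul {φ : ℝ → ℝ} {φ' : ℝ} {f : Euc m → ComplexClifford m} {x : Euc m}
    {k : ℕ} (h : HasDerivAt φ φ' (‖x‖ ^ 2)) (hf : DifferentiableAt ℝ f x) (hd : dirac f x = 0)
    (he : fderiv ℝ f x x = (k : ℝ) • f x) :
    dirac (fun y => φ (‖y‖ ^ 2) • (vec m y * f y)) x =
      -(2 * ‖x‖ ^ 2 * φ' + (m + 2 * k) * φ (‖x‖ ^ 2)) • f x := by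
  rw [dirac_radial_smul h (differentiableAt_vec_mul hf), dirac_vec_mul hf hd he, ← mul_assoc,
    vec_mul_self, smul_mul_assoc, one_mul]
  module

/-! ### Smoothness and homogeneity of spherical monogenics. -/

theorem contDiff_of_mem_sphericalMonogenics {k : ℕ} {Y : Euc m → ComplexClifford m}
    (hY : Y ∈ sphericalMonogenics m k) : ContDiff ℝ ∞ Y := by
  obtain ⟨⟨a, ha⟩, -⟩ := hY
  rw [funext ha]
  fun_prop

theorem smul_of_mem_sphericalMonogenics {k : ℕ} {Y : Euc m → ComplexClifford m}
    (hY : Y ∈ sphericalMonogenics m k) (r : ℝ) (x : Euc m) : Y (r • x) = r ^ k • Y x := by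
  obtain ⟨⟨a, ha⟩, -⟩ := hY
  rw [ha, ha, Finset.smul_sum]
  refine Finset.sum_congr rfl fun β hβ => ?_
  rw [Finset.mem_piAntidiag] at hβ
  simp only [PiLp.smul_apply, smul_eq_mul, mul_pow, Finset.prod_mul_distrib,
    Finset.prod_pow_eq_pow_sum, hβ.1, smul_smul]

/-- Euler's identity. -/
theorem fderiv_apply_self_of_mem_sphericalMonogenics {k : ℕ} {Y : Euc m → ComplexClifford m}
    (hY : Y ∈ sphericalMonogenics m k) (x : Euc m) : fderiv ℝ Y x x = (k : ℝ) • Y x := by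
  have hd : HasFDerivAt Y (fderiv ℝ Y x) ((1 : ℝ) • x) := by
    rw [one_smul]
    exact ((contDiff_of_mem_sphericalMonogenics hY).differentiable (by simp) x).hasFDerivAt
  have h1 : HasDerivAt (fun r : ℝ => Y (r • x)) (fderiv ℝ Y x x) 1 := by
    have h := hd.comp_hasDerivAt (1 : ℝ) ((hasDerivAt_id (1 : ℝ)).smul_const x)
    rw [one_smul] at h
    exact h
  have h2 : HasDerivAt (fun r : ℝ => Y (r • x)) ((k : ℝ) • Y x) 1 := by
    simp only [smul_of_mem_sphericalMonogenics hY]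
    simpa using (hasDerivAt_pow k (1 : ℝ)).smul_const (Y x)
  exact h1.unique h2

/-! ### Integration in polar coordinates. -/

theorem integral_volumeIoiPow {E : Type*} [NormedAddCommGroup E] [NormedSpace ℝ E] (n : ℕ)
    (f : ℝ → E) :
    ∫ r : Ioi (0 : ℝ), f r ∂(Measure.volumeIoiPow n) = ∫ r in Ioi (0 : ℝ), r ^ n • f r := by
  simp only [Measure.volumeIoiPow, ENNReal.ofReal]
  rw [integral_withDensity_eq_integral_smul,
    integral_subtype_comap measurableSet_Ioi fun a => Real.toNNReal (a ^ n) • f a,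
    setIntegral_congr_fun measurableSet_Ioi fun x hx => ?_]
  · rw [NNReal.smul_def, Real.coe_toNNReal _ (pow_nonneg (le_of_lt hx) _)]
  · exact (measurable_subtype_coe.pow_const _).real_toNNReal

/-- Polar coordinates for a radial function times a homogeneous function. -/
theorem integral_radial_smul_homogeneous {E F : Type*} [NormedAddCommGroup E] [NormedSpace ℝ E]
    [FiniteDimensional ℝ E] [MeasurableSpace E] [BorelSpace E] [Nontrivial E]
    [NormedAddCommGroup F] [NormedSpace ℝ F] (μ : Measure E) [μ.IsAddHaarMeasure]
    {f : E → F} {d : ℕ} (hf : ∀ (r : ℝ) (x : E), f (r • x) = r ^ d • f x) (ψ : ℝ → ℝ) :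
    ∫ x, ψ ‖x‖ • f x ∂μ = (∫ r in Ioi (0 : ℝ), r ^ (Module.finrank ℝ E - 1) * (r ^ d * ψ r)) •
      ∫ w : Metric.sphere (0 : E) 1, f w ∂μ.toSphere := by
  calc ∫ x, ψ ‖x‖ • f x ∂μ
      = ∫ x : ({0}ᶜ : Set E), ψ ‖(x : E)‖ • f x ∂(μ.comap (↑)) := by
        rw [integral_subtype_comap (measurableSet_singleton _).compl fun x => ψ ‖x‖ • f x,
          restrict_compl_singleton]
    _ = ∫ p : Metric.sphere (0 : E) 1 × Ioi (0 : ℝ), ((p.2 : ℝ) ^ d * ψ p.2) • f p.1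
          ∂(μ.toSphere.prod (Measure.volumeIoiPow (Module.finrank ℝ E - 1))) := by
        rw [← μ.measurePreserving_homeomorphUnitSphereProd.integral_comp
          (Homeomorph.measurableEmbedding _)]
        refine integral_congr_ae (Filter.Eventually.of_forall fun x => ?_)
        have hx : ‖(x : E)‖ ≠ 0 := norm_ne_zero_iff.2 x.2
        simp only [homeomorphUnitSphereProd_apply_snd_coe, homeomorphUnitSphereProd_apply_fst_coe]
        rw [hf, smul_smul, mul_right_comm, ← mul_pow, mul_inv_cancel₀ hx, one_pow, one_mul]
    _ = ∫ p : Ioi (0 : ℝ) × Metric.sphere (0 : E) 1, ((p.1 : ℝ) ^ d * ψ p.1) • f p.2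
          ∂((Measure.volumeIoiPow (Module.finrank ℝ E - 1)).prod μ.toSphere) := by
        rw [← integral_prod_swap]
        rfl
    _ = _ := by
        rw [integral_prod_smul (fun r : Ioi (0 : ℝ) => (r : ℝ) ^ d * ψ r)
          (fun w : Metric.sphere (0 : E) 1 => f w),
          integral_volumeIoiPow _ fun r : ℝ => r ^ d * ψ r]
        simp only [smul_eq_mul]

/-! ### Orthogonality on the sphere for different degrees. -/

theorem continuous_mulL {X : Type*} [TopologicalSpace X] {f g : X → ComplexClifford m}
    (hf : Continuous f) (hg : Continuous g) : Continuous fun x => f x * g x :=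
  (mulL m).continuous₂.comp (hf.prodMk hg)

theorem continuous_starL {X : Type*} [TopologicalSpace X] {f : X → ComplexClifford m}
    (hf : Continuous f) : Continuous fun x => star (f x) :=
  (starL m).continuous.comp hf

/-- The Dirac operator is symmetric up to a boundary term, so that its range on compactly supported
functions is orthogonal to monogenic functions. -/
theorem integral_star_mul_dirac {Y f : Euc m → ComplexClifford m} (hY : ContDiff ℝ ∞ Y)
    (hd : ∀ x, dirac Y x = 0) (hf : ContDiff ℝ ∞ f) (hc : HasCompactSupport f) :
    ∫ x, star (Y x) * dirac f x = 0 := by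
  have hY1 : ∀ v, Continuous fun x => fderiv ℝ Y x v := fun v =>
    (hY.continuous_fderiv (by simp)).clm_apply continuous_const
  have hf1 : ∀ v, Continuous fun x => fderiv ℝ f x v := fun v =>
    (hf.continuous_fderiv (by simp)).clm_apply continuous_const
  have hfc : ∀ v, HasCompactSupport fun x => fderiv ℝ f x v := fun v => hc.fderiv_apply ℝ v
  have hint : ∀ (a : ComplexClifford m) {u g : Euc m → ComplexClifford m}, Continuous u →
      Continuous g → HasCompactSupport g → Integrable fun x => star (u x) * a * g x := by
    intro a u g hu hg hgc
    refine (continuous_mulL (continuous_mulL (continuous_starL hu) continuous_const)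
      hg).integrable_of_hasCompactSupport (hgc.mono fun x hx => ?_)
    contrapose! hx
    simp [Function.notMem_support.1 hx]
  -- Integration by parts along the $j$-th axis for the bilinear pairing
  -- $(u,g)\mapsto\overline{u}\,e_j\,g$.
  have hj : ∀ j : Fin m, ∫ x, star (Y x) * gen j * fderiv ℝ f x (EuclideanSpace.single j 1) =
      -∫ x, star (fderiv ℝ Y x (EuclideanSpace.single j 1)) * gen j * f x := fun j =>
    integral_bilinear_hasLineDerivAt_right_eq_neg_left_of_integrable
      (B := (mulL m).comp (((mulL m).flip (gen j)).comp (starL m)))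
      (hint _ (hY1 _) hf.continuous hc) (hint _ hY.continuous (hf1 _) (hfc _))
      (hint _ hY.continuous hf.continuous hc)
      (fun x _ => (hY.differentiable (by simp) x).hasFDerivAt.hasLineDerivAt _)
      (fun x _ => (hf.differentiable (by simp) x).hasFDerivAt.hasLineDerivAt _)
  simp only [dirac, Finset.mul_sum, ← mul_assoc]
  rw [integral_finsetSum _ fun j _ => hint _ hY.continuous (hf1 _) (hfc _),
    Finset.sum_congr rfl fun j _ => hj j, Finset.sum_neg_distrib,
    ← integral_finsetSum _ fun j _ => hint _ (hY1 _) hf.continuous hc]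
  simp only [← Finset.sum_mul]
  -- Conjugating $\partial Y=0$ reverses the products, and $\overline{e_j}=-e_j$ costs only a global
  -- sign.
  have : ∀ x, ∑ j, star (fderiv ℝ Y x (EuclideanSpace.single j 1)) * gen j = 0 := by
    intro x
    have h := congrArg star (hd x)
    rw [dirac, star_sum, star_zero] at h
    simpa only [star_mul, star_gen, mul_neg, Finset.sum_neg_distrib, neg_eq_zero] using h
  simp [this]

theorem star_mul_homogeneous {k l : ℕ} {Y Z : Euc m → ComplexClifford m}
    (hY : Y ∈ sphericalMonogenics m k) (hZ : Z ∈ sphericalMonogenics m l) (r : ℝ) (x : Euc m) :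
    star (Y (r • x)) * Z (r • x) = r ^ (k + l) • (star (Y x) * Z x) := by
  rw [smul_of_mem_sphericalMonogenics hY, smul_of_mem_sphericalMonogenics hZ, star_smul_real,
    smul_mul_assoc, mul_smul_comm, smul_smul, pow_add]

/-- The `ℂₘ`-valued inner product over the unit sphere. -/
def sphereInner (Y Z : Euc m → ComplexClifford m) : ComplexClifford m :=
  ∫ w : Metric.sphere (0 : Euc m) 1, star (Y w) * Z w ∂((volume : Measure (Euc m)).toSphere)

theorem star_sphereInner {Y Z : Euc m → ComplexClifford m} (hY : Continuous Y)
    (hZ : Continuous Z) : star (sphereInner Y Z) = sphereInner Z Y := by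
  have hi : Integrable (fun w : Metric.sphere (0 : Euc m) 1 => star (Y w) * Z w)
      (volume : Measure (Euc m)).toSphere := by
    refine Continuous.integrable_of_hasCompactSupport ?_ (HasCompactSupport.of_compactSpace _)
    exact continuous_mulL (continuous_starL (hY.comp continuous_subtype_val))
      (hZ.comp continuous_subtype_val)
  have h := (starL m).integral_comp_comm hi
  simp only [starL_apply, star_mul, star_star] at h
  exact h.symm

theorem hasCompactSupport_comp_norm_sq {E : Type*} [NormedAddCommGroup E] [ProperSpace E]
    {φ : ℝ → ℝ} (hc : HasCompactSupport φ) : HasCompactSupport fun y : E => φ (‖y‖ ^ 2) := by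
  obtain ⟨R, hR⟩ := hc.isCompact.isBounded.subset_closedBall (0 : ℝ)
  refine HasCompactSupport.intro (isCompact_closedBall (0 : E) (|R| + 1)) fun y hy => ?_
  rw [← Function.notMem_support]
  intro h
  have h1 := hR (subset_tsupport _ h)
  rw [mem_closedBall_zero_iff, Real.norm_eq_abs] at h1
  rw [mem_closedBall_zero_iff, not_le] at hy
  nlinarith [le_abs_self (‖y‖ ^ 2), le_abs_self R, abs_nonneg R]

/-- Pairing `Y` with the Dirac operator of `φ(|x|²) x Z(x)`. -/
theorem radial_integral_smul_sphereInner_eq_zero {k l : ℕ} (hm : 1 ≤ m)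
    {Y Z : Euc m → ComplexClifford m}
    (hY : Y ∈ sphericalMonogenics m k) (hZ : Z ∈ sphericalMonogenics m l) {φ : ℝ → ℝ}
    (hφ : ContDiff ℝ ∞ φ) (hc : HasCompactSupport φ) :
    (∫ r in Ioi (0 : ℝ), r ^ (m - 1) * (r ^ (k + l) *
      (2 * r ^ 2 * deriv φ (r ^ 2) + (m + 2 * l) * φ (r ^ 2)))) • sphereInner Y Z = 0 := by
  have : Nonempty (Fin m) := ⟨⟨0, hm⟩⟩
  have hYc := contDiff_of_mem_sphericalMonogenics hY
  have hZc := contDiff_of_mem_sphericalMonogenics hZ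
  have hvZ : ContDiff ℝ ∞ fun y => vec m y * Z y :=
    ((mulL m).isBoundedBilinearMap.contDiff).comp₂ (vec m).contDiff hZc
  have h := integral_star_mul_dirac hYc hY.2 ((hφ.comp (contDiff_norm_sq ℝ)).smul hvZ)
    (hasCompactSupport_comp_norm_sq hc).smul_right
  have h2 : ∀ x, star (Y x) * dirac (fun y => φ (‖y‖ ^ 2) • (vec m y * Z y)) x =
      -((2 * ‖x‖ ^ 2 * deriv φ (‖x‖ ^ 2) + (m + 2 * l) * φ (‖x‖ ^ 2)) • (star (Y x) * Z x)) := by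
    intro x
    rw [dirac_radial_smul_vec_mul (hφ.differentiable (by simp) _).hasDerivAt
      (hZc.differentiable (by simp) x) (hZ.2 x) (fderiv_apply_self_of_mem_sphericalMonogenics hZ x),
      mul_smul_comm, neg_smul]
  have h3 : ∫ x, star (Y x) * dirac (fun y => φ (‖y‖ ^ 2) • (vec m y * Z y)) x = 0 := h
  simp only [h2] at h3
  rw [integral_neg, neg_eq_zero, integral_radial_smul_homogeneous volume
    (star_mul_homogeneous hY hZ) (fun r => 2 * r ^ 2 * deriv φ (r ^ 2) + (m + 2 * l) * φ (r ^ 2)),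
    finrank_euclideanSpace, Fintype.card_fin] at h3
  exact h3

/-- Spherical monogenics of different degrees are orthogonal over the unit sphere. -/
theorem sphereInner_eq_zero_of_ne {k l : ℕ} (hm : 1 ≤ m) (hkl : k ≠ l)
    {Y Z : Euc m → ComplexClifford m}
    (hY : Y ∈ sphericalMonogenics m k) (hZ : Z ∈ sphericalMonogenics m l) :
    sphereInner Y Z = 0 := by
  have φ : ContDiffBump (0 : ℝ) := default
  by_contra hne
  have h1 := (smul_eq_zero.1 (radial_integral_smul_sphereInner_eq_zero hm hY hZ φ.contDiff
    φ.hasCompactSupport)).resolve_right hne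
  have hne' : sphereInner Z Y ≠ 0 := by
    rw [← star_sphereInner (contDiff_of_mem_sphericalMonogenics hY).continuous
      (contDiff_of_mem_sphericalMonogenics hZ).continuous]
    simpa using hne
  -- The same bump with $Y$ and $Z$ exchanged: only the coefficient $m+2l$ changes, to $m+2k$.
  have h2 := (smul_eq_zero.1 (radial_integral_smul_sphereInner_eq_zero hm hZ hY φ.contDiff
    φ.hasCompactSupport)).resolve_right hne'
  have hsq : ∀ {g : ℝ → ℝ}, HasCompactSupport g → HasCompactSupport fun r : ℝ => g (r ^ 2) :=
    fun hg => by simpa using hasCompactSupport_comp_norm_sq (E := ℝ) hg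
  have hcφ : Continuous (deriv φ) := φ.contDiff.continuous_deriv (n := ∞) (by simp)
  have hi0 : Integrable fun r : ℝ => r ^ (m - 1) * (r ^ (k + l) * φ (r ^ 2)) := by
    refine Continuous.integrable_of_hasCompactSupport ?_ ((hsq φ.hasCompactSupport).mul_left.mul_left)
    have := φ.continuous
    fun_prop
  have hi1 : Integrable fun r : ℝ =>
      r ^ (m - 1) * (r ^ (k + l) * (2 * r ^ 2 * deriv φ (r ^ 2))) := by
    refine Continuous.integrable_of_hasCompactSupport ?_
      ((hsq φ.hasCompactSupport.deriv).mul_left.mul_left.mul_left)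
    fun_prop
  have key : ∀ s : ℝ, ∫ r in Ioi (0 : ℝ), r ^ (m - 1) * (r ^ (k + l) *
      (2 * r ^ 2 * deriv φ (r ^ 2) + (m + 2 * s) * φ (r ^ 2))) =
      (∫ r in Ioi (0 : ℝ), r ^ (m - 1) * (r ^ (k + l) * (2 * r ^ 2 * deriv φ (r ^ 2)))) +
      (m + 2 * s) * ∫ r in Ioi (0 : ℝ), r ^ (m - 1) * (r ^ (k + l) * φ (r ^ 2)) := by
    intro s
    rw [← integral_const_mul, ← integral_add hi1.restrict (hi0.restrict.const_mul _)]
    congr 1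
    ext r
    ring
  rw [key] at h1
  rw [add_comm l k, key] at h2
  have hpos : 0 < ∫ r in Ioi (0 : ℝ), r ^ (m - 1) * (r ^ (k + l) * φ (r ^ 2)) := by
    rw [setIntegral_pos_iff_support_of_nonneg_ae _ hi0.integrableOn]
    -- The minimum with $1$ ensures $r^2<r<$ `φ.rIn`, where the bump equals $1$.
    · refine lt_of_lt_of_le ?_ (measure_mono (s := Ioo 0 (min 1 φ.rIn)) fun r hr => ⟨?_, hr.1⟩)
      · simp [φ.rIn_pos]
      · have hr0 := hr.1
        have hr1 : r < 1 := hr.2.trans_le (min_le_left _ _)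
        have hr2 : r < φ.rIn := hr.2.trans_le (min_le_right _ _)
        have : φ (r ^ 2) = 1 := by
          apply φ.one_of_mem_closedBall
          rw [mem_closedBall_zero_iff, Real.norm_eq_abs, abs_of_nonneg (by positivity)]
          nlinarith
        rw [Function.mem_support, this]
        positivity
    · filter_upwards [ae_restrict_mem measurableSet_Ioi] with r hr
      have hr0 : 0 < r := hr
      have := φ.nonneg (x := r ^ 2)
      simp only [Pi.zero_apply]
      positivity
  have h3 : 2 * ((l : ℝ) - k) * ∫ r in Ioi (0 : ℝ), r ^ (m - 1) * (r ^ (k + l) * φ (r ^ 2)) = 0 := by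
    linear_combination h1 - h2
  have h4 : (l : ℝ) - k ≠ 0 := sub_ne_zero.2 (by exact_mod_cast hkl.symm)
  exact (mul_ne_zero (mul_ne_zero two_ne_zero h4) hpos.ne') h3

/-! ### The radial Sturm–Liouville equation. -/

theorem differentiableAt_and_deriv_of_contDiffOn {F : ℝ → ℝ} (hF : ContDiffOn ℝ ∞ F (Icc 0 1)) {t : ℝ}
    (ht : t ∈ Ioo (0 : ℝ) 1) : DifferentiableAt ℝ F t ∧ DifferentiableAt ℝ (deriv F) t := by
  have h : ContDiffOn ℝ ∞ F (Ioo 0 1) := hF.mono Ioo_subset_Icc_self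
  have hn := isOpen_Ioo.mem_nhds ht
  refine ⟨(h.contDiffAt hn).differentiableAt (by simp), ?_⟩
  exact (((contDiffOn_infty_iff_deriv_of_isOpen isOpen_Ioo).1 h).2.contDiffAt hn).differentiableAt
    (by simp)

/-- The radial form of `L_{c,α}` on `F(|x|²) Y(x)`. -/
theorem opL_radialMul {k : ℕ} {c α : ℝ} {F : ℝ → ℝ} (hF : ContDiffOn ℝ ∞ F (Icc 0 1))
    {Y : Euc m → ComplexClifford m} (hY : Y ∈ sphericalMonogenics m k) {x : Euc m} {H' : ℝ}
    (hx : ‖x‖ ^ 2 ∈ Ioo (0 : ℝ) 1)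
    (hH : HasDerivAt (fun t => (1 - t) ^ (α + 1) * (2 * deriv F t)) H' (‖x‖ ^ 2)) :
    opL c α (radialMul F Y) x =
      ((1 - ‖x‖ ^ 2) ^ (-α) * -(2 * ‖x‖ ^ 2 * H' + (m + 2 * k) *
        ((1 - ‖x‖ ^ 2) ^ (α + 1) * (2 * deriv F (‖x‖ ^ 2)))) +
        4 * Real.pi ^ 2 * c ^ 2 * ‖x‖ ^ 2 * F (‖x‖ ^ 2)) • Y x := by
  have hYd : Differentiable ℝ Y := (contDiff_of_mem_sphericalMonogenics hY).differentiable (by simp)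
  -- The outer derivative needs the inner one on a whole neighbourhood. The origin stays excluded
  -- because $F$ is unconstrained for negative arguments, so `deriv F 0` carries no information.
  have hev : (fun y => ((1 - ‖y‖ ^ 2) ^ (α + 1) : ℝ) • dirac (radialMul F Y) y) =ᶠ[nhds x]
      fun y => (fun t => (1 - t) ^ (α + 1) * (2 * deriv F t)) (‖y‖ ^ 2) • (vec m y * Y y) := by
    have hc : Continuous fun y : Euc m => ‖y‖ ^ 2 := by fun_prop
    filter_upwards [hc.continuousAt.preimage_mem_nhds (isOpen_Ioo.mem_nhds hx)] with y hy
    have h := dirac_radial_smul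
      (differentiableAt_and_deriv_of_contDiffOn hF hy).1.hasDerivAt (hYd y)
    rw [hY.2 y, smul_zero, zero_add] at h
    have h' : dirac (radialMul F Y) y = (2 * deriv F (‖y‖ ^ 2)) • (vec m y * Y y) := h
    rw [h', smul_smul]
  rw [opL, dirac_congr hev, dirac_radial_smul_vec_mul hH (hYd x) (hY.2 x)
    (fderiv_apply_self_of_mem_sphericalMonogenics hY x), radialMul]
  module

/-- The radial equation in Sturm–Liouville form. -/
theorem SolvesEven.hasDerivAt {k : ℕ} {c α χ : ℝ} {F : ℝ → ℝ} (h : SolvesEven m k c α χ F)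
    {Y : Euc m → ComplexClifford m} (hY : Y ∈ sphericalMonogenics m k)
    {w : Metric.sphere (0 : Euc m) 1} (hw : Y w ≠ 0) {t : ℝ} (ht : t ∈ Ioo (0 : ℝ) 1) :
    HasDerivAt (fun s => s ^ (k + m / 2 : ℝ) * ((1 - s) ^ (α + 1) * deriv F s))
      ((4 * Real.pi ^ 2 * c ^ 2 * t - χ) / 4 * F t *
        (t ^ ((k : ℝ) + (m : ℝ) / 2 - 1) * (1 - t) ^ α)) t := by
  obtain ⟨ht0, ht1⟩ := ht
  have h1t : 0 < 1 - t := by linarith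
  -- A point with $|x|^2=t$ at which $Y\ne0$, so that $Y(x)$ can be cancelled from the eigenvalue
  -- equation.
  set x : Euc m := Real.sqrt t • (w : Euc m) with hx
  have hwn : ‖(w : Euc m)‖ = 1 := norm_eq_of_mem_sphere w
  have hxn : ‖x‖ ^ 2 = t := by
    rw [hx, norm_smul, hwn, mul_one, Real.norm_eq_abs, sq_abs, Real.sq_sqrt ht0.le]
  have hYx : Y x ≠ 0 := by
    rw [hx, smul_of_mem_sphericalMonogenics hY]
    exact smul_ne_zero (pow_ne_zero _ (Real.sqrt_ne_zero'.2 ht0)) hw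
  have hG : DifferentiableAt ℝ (fun s => (1 - s) ^ (α + 1) * deriv F s) t := by
    refine DifferentiableAt.mul ?_ (differentiableAt_and_deriv_of_contDiffOn h.smooth ⟨ht0, ht1⟩).2
    exact ((differentiableAt_const _).sub differentiableAt_id).rpow_const (Or.inl h1t.ne')
  set G := fun s => (1 - s) ^ (α + 1) * deriv F s with hGdef
  have hH : HasDerivAt (fun t => (1 - t) ^ (α + 1) * (2 * deriv F t)) (2 * deriv G t) (‖x‖ ^ 2) := by
    rw [hxn]
    refine (hG.hasDerivAt.const_mul 2).congr_of_eventuallyEq (Filter.Eventually.of_forall fun s => ?_)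
    simp only [hGdef]
    ring
  have hball : x ∈ Metric.ball (0 : Euc m) 1 := by
    rw [mem_ball_zero_iff]
    nlinarith [norm_nonneg x]
  have heq := h.eqn Y hY x hball
  rw [opL_radialMul h.smooth hY (by rw [hxn]; exact ⟨ht0, ht1⟩) hH, radialMul, smul_smul] at heq
  have heq := smul_left_injective ℝ hYx heq
  simp only [hxn] at heq
  have hder := (Real.hasDerivAt_rpow_const (p := (k + m / 2 : ℝ)) (Or.inl ht0.ne')).mul
    hG.hasDerivAt
  refine hder.congr_deriv ?_
  have hα : (1 - t) ^ α * (1 - t) ^ (-α) = 1 := by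
    rw [← Real.rpow_add h1t, add_neg_cancel, Real.rpow_zero]
  have hκ : t ^ (k + m / 2 : ℝ) = t * t ^ ((k : ℝ) + m / 2 - 1) := by
    rw [Real.rpow_sub_one ht0.ne']
    field_simp
  have hGt : G t = (1 - t) ^ (α + 1) * deriv F t := rfl
  rw [hκ]
  rw [show (1 - t) ^ (α + 1) * (2 * deriv F t) = 2 * G t by rw [hGt]; ring] at heq
  -- The integrating factor $-\tfrac14t^{k+m/2-1}(1-t)^\alpha$ puts the equation in divergence form;
  -- `hα` removes $(1-t)^{\pm\alpha}$ from the second-order part.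
  linear_combination (-(t ^ ((k : ℝ) + m / 2 - 1)) * (1 - t) ^ α / 4) * heq +
    (t ^ ((k : ℝ) + m / 2 - 1) / 4) * (-(2 * t * (2 * deriv G t) + (m + 2 * k) * (2 * G t))) * hα

/-! ### Orthogonality of the radial parts. -/

theorem intervalIntegrable_weight {κ α : ℝ} (hκ : 0 ≤ κ) (hα : -1 < α) :
    IntervalIntegrable (fun t : ℝ => t ^ κ * (1 - t) ^ α) volume 0 1 := by
  have h := (intervalIntegral.intervalIntegrable_rpow' (a := 0) (b := 1) hα).comp_sub_left 1
  simp only [sub_zero, sub_self] at h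
  exact h.symm.continuousOn_mul (continuousOn_id.rpow_const fun _ _ => Or.inr hκ)

/-- Radial parts belonging to different eigenvalues are orthogonal. -/
theorem SolvesEven.integral_mul_eq_zero {k : ℕ} {c α χ χ' : ℝ} {F G : ℝ → ℝ} (hm : 2 ≤ m)
    (hα : -1 < α) (hF : SolvesEven m k c α χ F) (hG : SolvesEven m k c α χ' G) (hχ : χ ≠ χ')
    {Y : Euc m → ComplexClifford m} (hY : Y ∈ sphericalMonogenics m k)
    {w : Metric.sphere (0 : Euc m) 1} (hw : Y w ≠ 0) :
    ∫ t in (0 : ℝ)..1, F t * G t * (t ^ ((k : ℝ) + (m : ℝ) / 2 - 1) * (1 - t) ^ α) = 0 := by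
  have hm' : (2 : ℝ) ≤ m := by exact_mod_cast hm
  have hκ : 0 ≤ (k : ℝ) + (m : ℝ) / 2 - 1 := by
    have : (0 : ℝ) ≤ k := k.cast_nonneg
    linarith
  have hu : UniqueDiffOn ℝ (Icc (0 : ℝ) 1) := uniqueDiffOn_Icc one_pos
  -- One-sided derivatives are continuous up to the endpoints, whereas `deriv` there depends on
  -- values outside $[0,1]$.
  set F1 := derivWithin F (Icc 0 1)
  set G1 := derivWithin G (Icc 0 1)
  have hF1 : ContinuousOn F1 (Icc 0 1) :=
    ((contDiffOn_infty_iff_derivWithin hu).1 hF.smooth).2.continuousOn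
  have hG1 : ContinuousOn G1 (Icc 0 1) :=
    ((contDiffOn_infty_iff_derivWithin hu).1 hG.smooth).2.continuousOn
  have hFd : ∀ t ∈ Ioo (0 : ℝ) 1, F1 t = deriv F t := fun t ht =>
    derivWithin_of_mem_nhds (Icc_mem_nhds ht.1 ht.2)
  have hGd : ∀ t ∈ Ioo (0 : ℝ) 1, G1 t = deriv G t := fun t ht =>
    derivWithin_of_mem_nhds (Icc_mem_nhds ht.1 ht.2)
  -- The weighted Wronskian $p\,(F'G-FG')$: in its derivative the $c$-terms cancel and only
  -- $\chi'-\chi$ remains.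
  let W : ℝ → ℝ := fun s => s ^ (k + m / 2 : ℝ) * (1 - s) ^ (α + 1) * (F1 s * G s - F s * G1 s)
  have hW : ContinuousOn W (Icc 0 1) := by
    refine ContinuousOn.mul (ContinuousOn.mul ?_ ?_) ((hF1.mul hG.smooth.continuousOn).sub
      (hF.smooth.continuousOn.mul hG1))
    · exact continuousOn_id.rpow_const fun _ _ => Or.inr (by linarith)
    · exact (continuousOn_const.sub continuousOn_id).rpow_const fun _ _ => Or.inr (by linarith)
  have hd : ∀ t ∈ Ioo (0 : ℝ) 1, HasDerivAt W ((χ' - χ) / 4 *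
      (F t * G t * (t ^ ((k : ℝ) + (m : ℝ) / 2 - 1) * (1 - t) ^ α))) t := by
    intro t ht
    have h1 := (hF.hasDerivAt hY hw ht).mul
      (differentiableAt_and_deriv_of_contDiffOn hG.smooth ht).1.hasDerivAt
    have h2 := (hG.hasDerivAt hY hw ht).mul
      (differentiableAt_and_deriv_of_contDiffOn hF.smooth ht).1.hasDerivAt
    refine ((h1.sub h2).congr_of_eventuallyEq ?_).congr_deriv (by ring)
    filter_upwards [isOpen_Ioo.mem_nhds ht] with s hs
    simp only [W, hFd s hs, hGd s hs, Pi.sub_apply, Pi.mul_apply]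
    ring
  have hi : IntervalIntegrable (fun t => (χ' - χ) / 4 *
      (F t * G t * (t ^ ((k : ℝ) + (m : ℝ) / 2 - 1) * (1 - t) ^ α))) volume 0 1 := by
    refine ((intervalIntegrable_weight hκ hα).continuousOn_mul ?_).const_mul _
    rw [uIcc_of_le zero_le_one]
    exact hF.smooth.continuousOn.mul hG.smooth.continuousOn
  have h := intervalIntegral.integral_eq_sub_of_hasDerivAt_of_le zero_le_one hW hd hi
  -- The boundary terms vanish because the exponents $k+m/2$ and $\alpha+1$ are positive.
  have hW0 : W 0 = 0 := by
    simp only [W]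
    rw [Real.zero_rpow (by linarith)]
    ring
  have hW1 : W 1 = 0 := by
    simp only [W]
    rw [sub_self, Real.zero_rpow (by linarith)]
    ring
  rw [intervalIntegral.integral_const_mul, hW0, hW1, sub_self] at h
  exact (mul_eq_zero.1 h).resolve_left (div_ne_zero (sub_ne_zero.2 hχ.symm) four_ne_zero)

/-! ### The weighted space on the ball. -/

theorem isFiniteMeasure_ballMeasure (hm : 1 ≤ m) {α : ℝ} (hα : -1 < α) :
    IsFiniteMeasure (ballMeasure m α) := by
  have : Nonempty (Fin m) := ⟨⟨0, hm⟩⟩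
  refine isFiniteMeasure_withDensity_ofReal ?_
  have h : Integrable (fun x : Euc m => (Iio (1 : ℝ)).indicator (fun r => (1 - r ^ 2) ^ α) ‖x‖) := by
    rw [integrable_fun_norm_addHaar volume
      (f := fun r => (Iio (1 : ℝ)).indicator (fun r => (1 - r ^ 2) ^ α) r)]
    -- Factor $(1-r^2)^\alpha=(1+r)^\alpha(1-r)^\alpha$: only the second factor can be singular. The
    -- factor $r^0$ is there to match `intervalIntegrable_weight` with $\kappa=0$.
    have h1 : IntervalIntegrable (fun r : ℝ => (r ^ (m - 1) * (1 + r) ^ α) *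
        (r ^ (0 : ℝ) * (1 - r) ^ α)) volume 0 1 := by
      refine (intervalIntegrable_weight le_rfl hα).continuousOn_mul ?_
      rw [uIcc_of_le zero_le_one]
      refine (continuousOn_pow _).mul ((continuousOn_const.add continuousOn_id).rpow_const ?_)
      intro r hr
      have : (0 : ℝ) ≤ r := hr.1
      exact Or.inl (by change 1 + r ≠ 0; positivity)
    rw [intervalIntegrable_iff_integrableOn_Ioo_of_le zero_le_one,
      ← integrable_indicator_iff measurableSet_Ioo] at h1
    rw [← integrable_indicator_iff measurableSet_Ioi]
    refine h1.congr (Filter.Eventually.of_forall fun r => ?_)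
    simp only [indicator_apply, mem_Ioo, mem_Ioi, mem_Iio, finrank_euclideanSpace, Fintype.card_fin]
    by_cases h0 : 0 < r
    · by_cases h1 : r < 1
      · rw [if_pos ⟨h0, h1⟩, if_pos h0, if_pos h1, Real.rpow_zero, one_mul, smul_eq_mul, mul_assoc,
          ← Real.mul_rpow (by linarith) (by linarith)]
        congr 2
        ring
      · simp [h0, h1]
    · simp [h0]
  refine (h.integrableOn (s := Metric.ball 0 1)).congr_fun (fun x hx => ?_)
    measurableSet_ball |>.2
  rw [indicator_of_mem]
  simpa using hx

/-- A function continuous on the closed ball is bounded there, and the measure is finite. -/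
theorem memLp_radialMul (hm : 1 ≤ m) {α : ℝ} (hα : -1 < α) {P : ℝ → ℝ}
    (hP : ContinuousOn P (Icc 0 1)) {Y : Euc m → ComplexClifford m} (hY : Continuous Y) :
    MemLp (radialMul P Y) 2 (ballMeasure m α) := by
  have := isFiniteMeasure_ballMeasure hm hα
  have hc : ContinuousOn (radialMul P Y) (Metric.closedBall 0 1) := by
    have hP' : ContinuousOn (fun x : Euc m => P (‖x‖ ^ 2)) (Metric.closedBall 0 1) := by
      refine hP.comp (by fun_prop) fun x hx => ?_
      rw [mem_closedBall_zero_iff] at hx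
      exact ⟨by positivity, pow_le_one₀ (norm_nonneg _) hx⟩
    exact hP'.smul hY.continuousOn
  obtain ⟨C, hC⟩ := (isCompact_closedBall (0 : Euc m) 1).exists_bound_of_continuousOn hc
  have hac : ballMeasure m α ≪ volume.restrict (Metric.ball (0 : Euc m) 1) :=
    withDensity_absolutelyContinuous _ _
  refine MemLp.of_bound ?_ C ?_
  · exact ((hc.mono Metric.ball_subset_closedBall).aestronglyMeasurable
      measurableSet_ball).mono_ac hac
  · refine hac.ae_le ?_
    filter_upwards [ae_restrict_mem measurableSet_ball] with x hx
    exact hC x (Metric.ball_subset_closedBall hx)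

theorem weightedInner_radialMul (hm : 1 ≤ m) (α : ℝ) (F G : ℝ → ℝ) {k l : ℕ}
    {Y Z : Euc m → ComplexClifford m} (hY : Y ∈ sphericalMonogenics m k)
    (hZ : Z ∈ sphericalMonogenics m l) :
    weightedInner α (radialMul F Y) (radialMul G Z) =
      (∫ r in Ioi (0 : ℝ), r ^ (m - 1) * (r ^ (k + l) * (Iio (1 : ℝ)).indicator
        (fun r => (1 - r ^ 2) ^ α * (F (r ^ 2) * G (r ^ 2))) r)) • sphereInner Y Z := by
  have : Nonempty (Fin m) := ⟨⟨0, hm⟩⟩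
  have h := integral_radial_smul_homogeneous (volume : Measure (Euc m))
    (f := fun x => star (Y x) * Z x) (star_mul_homogeneous hY hZ)
    ((Iio (1 : ℝ)).indicator (fun r => (1 - r ^ 2) ^ α * (F (r ^ 2) * G (r ^ 2))))
  rw [finrank_euclideanSpace, Fintype.card_fin] at h
  rw [sphereInner, ← h, weightedInner, ballMeasure, integral_withDensity_eq_integral_toReal_smul
    (by fun_prop) (by simp), ← integral_indicator measurableSet_ball]
  congr 1
  ext1 x
  by_cases hx : ‖x‖ < 1
  · rw [indicator_of_mem (by simpa using hx), indicator_of_mem (by simpa using hx),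
      ENNReal.toReal_ofReal (Real.rpow_nonneg (by nlinarith [norm_nonneg x]) _), radialMul, radialMul,
      star_smul_real, smul_mul_assoc, mul_smul_comm, smul_smul, smul_smul, mul_assoc]
  · rw [indicator_of_notMem (by simpa using hx), indicator_of_notMem (by simpa using hx), zero_smul]

/-- Substitute $t=r^2$: $r^{m-1+2k}=r\,(r^2)^{k+m/2-1}$, and $r\,dr=\tfrac12\,dt$ is the source of
the $\tfrac12$. -/
theorem integral_radial_eq_half (hm : 1 ≤ m) (k : ℕ) (α : ℝ) (F : ℝ → ℝ) :
    ∫ r in Ioi (0 : ℝ), r ^ (m - 1) * (r ^ (k + k) * (Iio (1 : ℝ)).indicator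
        (fun r => (1 - r ^ 2) ^ α * F (r ^ 2)) r) =
      1 / 2 * ∫ t in (0 : ℝ)..1, F t * (t ^ ((k : ℝ) + (m : ℝ) / 2 - 1) * (1 - t) ^ α) := by
  have h := integral_comp_rpow_Ioi_of_pos (p := 2) (g := (Iio (1 : ℝ)).indicator
    fun t => F t * (t ^ ((k : ℝ) + (m : ℝ) / 2 - 1) * (1 - t) ^ α)) two_pos
  rw [setIntegral_indicator measurableSet_Iio, Ioi_inter_Iio, ← integral_Ioc_eq_integral_Ioo,
    ← intervalIntegral.integral_of_le zero_le_one] at h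
  rw [← h, ← integral_const_mul]
  refine setIntegral_congr_fun measurableSet_Ioi fun r hr => ?_
  have hr : 0 < r := hr
  simp only [indicator_apply, mem_Iio, smul_eq_mul]
  rw [Real.rpow_two]
  by_cases h1 : r < 1
  · have h2 : r ^ 2 < 1 := by nlinarith
    rw [if_pos h1, if_pos h2]
    have h3 : r ^ (2 - 1 : ℝ) * (r ^ 2) ^ ((k : ℝ) + (m : ℝ) / 2 - 1) =
        r ^ (m - 1) * r ^ (k + k) := by
      rw [← Real.rpow_natCast r 2, ← Real.rpow_mul hr.le, ← Real.rpow_add hr, ← pow_add,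
        ← Real.rpow_natCast r (m - 1 + (k + k))]
      congr 1
      push_cast [hm]
      ring
    linear_combination (-(1 - r ^ 2) ^ α * F (r ^ 2)) * h3
  · have h2 : ¬ r ^ 2 < 1 := by nlinarith
    rw [if_neg h1, if_neg h2]
    simp

end CPSWF

end

/-! ### Square integrability and orthogonality. -/

theorem mainTheorem3 (m : ℕ) (hm : 2 ≤ m) (c α : ℝ) (hc : 0 ≤ c) (hα : -1 < α)
    (Y : (k : ℕ) → Fin (Nat.choose (m + k - 2) k) → CPSWF.Euc m → CPSWF.ComplexClifford m)
    (hY : ∀ k, CPSWF.IsOrthonormalBasis m k (Y k))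
    (P : ℕ → ℕ → ℝ → ℝ) :
    (∀ (k N : ℕ) (i : Fin (Nat.choose (m + k - 2) k)),
      CPSWF.IsEvenRadialPart m k N c α (P k N) →
      MeasureTheory.MemLp (CPSWF.radialMul (P k N) (Y k i)) 2 (CPSWF.ballMeasure m α)) ∧
    ∀ (k k' N N' : ℕ) (i : Fin (Nat.choose (m + k - 2) k))
      (i' : Fin (Nat.choose (m + k' - 2) k')),
      CPSWF.IsEvenRadialPart m k N c α (P k N) →
      CPSWF.IsEvenRadialPart m k' N' c α (P k' N') →
      CPSWF.weightedInner α (CPSWF.radialMul (P k N) (Y k i))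
          (CPSWF.radialMul (P k' N') (Y k' i')) =
        if N = N' ∧ k = k' ∧ (i : ℕ) = (i' : ℕ) then (1 / 2 : ℝ) • 1 else 0 := by
  have hm1 : 1 ≤ m := by omega
  refine ⟨fun k N i hP => ?_, fun k k' N N' i i' hP hP' => ?_⟩
  · obtain ⟨⟨χ, hχ, -⟩, -⟩ := hP
    exact CPSWF.memLp_radialMul hm1 hα hχ.smooth.continuousOn
      (CPSWF.contDiff_of_mem_sphericalMonogenics ((hY k).mem i)).continuous
  rw [CPSWF.weightedInner_radialMul hm1 α _ _ ((hY k).mem i) ((hY k').mem i')]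
  -- Degrees are compared first: `i` and `i'` share a type only once $k=k'$.
  by_cases hk : k = k'
  swap
  · rw [CPSWF.sphereInner_eq_zero_of_ne hm1 hk ((hY k).mem i) ((hY k').mem i'), smul_zero,
      if_neg fun h => hk h.2.1]
  subst hk
  have hs : CPSWF.sphereInner (Y k i) (Y k i') = if i = i' then 1 else 0 := (hY k).orthonormal i i'
  rw [hs]
  by_cases hi : i = i'
  swap
  · rw [if_neg hi, smul_zero, if_neg fun h => hi (Fin.ext h.2.2)]
  subst hi
  rw [CPSWF.integral_radial_eq_half hm1 k α fun t => P k N t * P k N' t]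
  obtain ⟨⟨χ, hχ, hN⟩, hn⟩ := hP
  obtain ⟨⟨χ', hχ', hN'⟩, -⟩ := hP'
  by_cases hNN : N = N'
  · subst hNN
    simp only [pow_two] at hn
    simp [hn]
  · have hne : χ ≠ χ' := by
      -- An eigenvalue determines its index, namely the number of eigenvalues below it.
      rintro rfl
      exact hNN (by exact_mod_cast hN.symm.trans hN')
    -- If $Y_k^i$ vanished on the sphere, its normalisation would read $0=1$ in the nontrivial ring
    -- $\mathbb{C}_m$.
    obtain ⟨w, hw⟩ : ∃ w : Metric.sphere (0 : CPSWF.Euc m) 1, Y k i w ≠ 0 := by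
      by_contra! h0
      have h1 := (hY k).orthonormal i i
      simp [h0] at h1
    rw [hχ.integral_mul_eq_zero hm hα hχ' hne ((hY k).mem i) hw, mul_zero, zero_smul,
      if_neg fun h => hNN h.1]
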